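/- Let $d \le 4$ and $n \ge 1$, let $\ell_i \le u_i$ ($i = 1,\dots,d$) be real numbers, let $X = \{x \in \mathbb{R}^d : \ell_i \le x_i \le u_i,\ i = 1,\dots,d\}$ and $F(x,\xi) = \frac12\|x\|^2 - \xi^T x$, and let $\Sigma \in \mathbb{R}^{d\times d}$ be any covariance matrix (symmetric positive semidefinite, possibly singular). The states of nature are the vectors $\mu \in \mathbb{R}^d$; in state $\mu$ one observes $n$ independent samples $\xi^1,\dots,\xi^n$ of $\xi \sim N(\mu,\Sigma)$. The loss of $x \in X$ in state $\mu$ is the optimality gap $\mathcal{L}(\mu,x) = \mathbb{E}_{\xi\sim N(\mu,\Sigma)}[F(x,\xi)] - \min_{z\in X}\mathbb{E}_{\xi\sim N(\mu,\Sigma)}[F(z,\xi)]$. Let $\Delta^n$ be the set of all decision rules $\delta : (\mathbb{R}^d)^n \to X$ such that $\mathbb{E}[\delta(\xi^1,\dots,\xi^n)]$ exists in every state $\mu$, and let the risk of $\delta \in \Delta^n$ be $\mathcal{R}(\mu,\delta) = \mathbb{E}[\mathcal{L}(\mu,\delta(\xi^1,\dots,\xi^n))]$. The sample average rule $\delta^n_{SA}$,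 defined by $\delta^n_{SA}(\xi^1,\dots,\xi^n) \in \arg\min\{\frac1n\sum_{i=1}^n F(x,\xi^i) : x \in X\}$, exists and is unique. With $\overline\xi = \frac1n\sum_{i=1}^n \xi^i$, its value is the minimizer of $\frac12\|x\|^2 - \overline\xi^T x$ over $x \in X$, which is the Euclidean projection of $\overline\xi$ onto $X$. It is admissible within $\Delta^n$: it belongs to $\Delta^n$, and there is no $\delta \in \Delta^n$ with $\mathcal{R}(\mu,\delta) \le \mathcal{R}(\mu,\delta^n_{SA})$ for all $\mu \in \mathbb{R}^d$ and $\mathcal{R}(\hat\mu,\delta) < \mathcal{R}(\hat\mu,\delta^n_{SA})$ for some $\hat\mu \in \mathbb{R}^d$. -/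

import Mathlib

open MeasureTheory ProbabilityTheory

noncomputable section

namespace StochOpt

/-- `z ∈ argmin {g x : x ∈ X}`. -/
def IsArgmin {A : Type*} (g : A → ℝ) (X : Set A) (z : A) : Prop :=
  z ∈ X ∧ ∀ x ∈ X, g z ≤ g x

/-! ### Stochastic optimization `min {f x := E_{ξ ∼ D}[F (x, ξ)] : x ∈ X}` -/

/-- The objective `f x = E_{ξ ∼ D}[F (x, ξ)]`. -/
def objective {A Ξ : Type*} [MeasurableSpace Ξ] (F : A → Ξ → ℝ) (D : Measure Ξ) (x : A) : ℝ :=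
  ∫ ξ, F x ξ ∂D

/-- The loss of the action `x` under the distribution `D`: its optimality gap, that is, `f x` minus
the optimal value of `f` on `X`. -/
def loss {A Ξ : Type*} [MeasurableSpace Ξ] (F : A → Ξ → ℝ) (X : Set A) (D : Measure Ξ) (x : A) :
    ℝ :=
  objective F D x - sInf (objective F D '' X)

/-- The loss is `f x - f z` for any optimal solution `z`. -/
theorem loss_eq_of_isArgmin {A Ξ : Type*} [MeasurableSpace Ξ] (F : A → Ξ → ℝ) (X : Set A)
    (D : Measure Ξ) (x z : A) (hz : IsArgmin (objective F D) X z) :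
    loss F X D x = objective F D x - objective F D z := by
  have h : IsLeast (objective F D '' X) (objective F D z) :=
    ⟨⟨z, hz.1, rfl⟩, by rintro _ ⟨w, hw, rfl⟩; exact hz.2 w hw⟩
  rw [loss, h.csInf_eq]

/-! ### Decision rules based on `n` i.i.d. samples, states of nature `θ : Θ` with laws `D θ` -/

/-- The law of `n` i.i.d. samples from `D`. -/
def sampleLaw {Ξ : Type*} [MeasurableSpace Ξ] (n : ℕ) (D : Measure Ξ) : Measure (Fin n → Ξ) :=
  Measure.pi fun _ => D

/-- The risk `R (θ, δ) = E_{y ∼ D θ × ⋯ × D θ}[L (D θ, δ y)]`. -/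
def risk {A Ξ Θ : Type*} [MeasurableSpace Ξ] (F : A → Ξ → ℝ) (X : Set A) (D : Θ → Measure Ξ)
    (n : ℕ) (θ : Θ) (δ : (Fin n → Ξ) → A) : ℝ :=
  ∫ y, loss F X (D θ) (δ y) ∂(sampleLaw n (D θ))

/-- The class of decision rules: maps from the sample space to `X` whose expectation exists under
every state of nature. -/
def decisionRules {A Ξ Θ : Type*} [NormedAddCommGroup A] [MeasurableSpace Ξ] (X : Set A)
    (D : Θ → Measure Ξ) (n : ℕ) : Set ((Fin n → Ξ) → A) :=
  {δ | (∀ y, δ y ∈ X) ∧ ∀ θ, Integrable δ (sampleLaw n (D θ))}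

/-- `δ'` dominates `δ`: its risk is nowhere larger, and it is somewhere strictly smaller. -/
def Dominates {A Ξ Θ : Type*} [MeasurableSpace Ξ] (F : A → Ξ → ℝ) (X : Set A) (D : Θ → Measure Ξ)
    (n : ℕ) (δ' δ : (Fin n → Ξ) → A) : Prop :=
  (∀ θ, risk F X D n θ δ' ≤ risk F X D n θ δ) ∧ ∃ θ, risk F X D n θ δ' < risk F X D n θ δ

/-- `δ` belongs to the class of decision rules and no rule of that class dominates it. -/
def IsAdmissible {A Ξ Θ : Type*} [NormedAddCommGroup A] [MeasurableSpace Ξ] (F : A → Ξ → ℝ)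
    (X : Set A) (D : Θ → Measure Ξ) (n : ℕ) (δ : (Fin n → Ξ) → A) : Prop :=
  δ ∈ decisionRules X D n ∧ ¬ ∃ δ' ∈ decisionRules X D n, Dominates F X D n δ' δ

/-- `δ` is a sample average rule:
`δ (ξ¹, …, ξⁿ) ∈ argmin {(1 / n) ∑ i, F (x, ξⁱ) : x ∈ X}` for all samples. -/
def IsSampleAverageRule {A Ξ : Type*} (F : A → Ξ → ℝ) (X : Set A) (n : ℕ)
    (δ : (Fin n → Ξ) → A) : Prop :=
  ∀ y, IsArgmin (fun x => (1 / (n : ℝ)) * ∑ i, F x (y i)) X (δ y)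

/-! ### The quadratic problem over a box -/

/-- The box `{x : l i ≤ x i ≤ u i for all i}`. -/
def box {d : ℕ} (l u : Fin d → ℝ) : Set (EuclideanSpace ℝ (Fin d)) :=
  {x | ∀ i, l i ≤ x i ∧ x i ≤ u i}

/-- `F (x, ξ) = ‖x‖² / 2 - ξᵀ x`. -/
def quadCost {d : ℕ} (x ξ : EuclideanSpace ℝ (Fin d)) : ℝ :=
  1 / 2 * ‖x‖ ^ 2 - inner ℝ ξ x

/-- The sample average `(1 / n) ∑ i, ξⁱ`. -/
def sampleMean {d n : ℕ} (y : Fin n → EuclideanSpace ℝ (Fin d)) : EuclideanSpace ℝ (Fin d) :=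
  (1 / (n : ℝ)) • ∑ i, y i

end StochOpt

end

/-! The argument is Blyth's method with Gaussian priors. Suppose a rule `δ` dominates the sample
average rule, strictly in state `m₀`. Only the states `m₀ + A θ` with `A = √S` are used: there the
samples are `m₀ + A (w i)` with `w i = θ + z i` and independent standard Gaussian `z i`, so a
singular `S` needs no separate treatment.

Under the prior `θ ∼ N(0, τ² I)` the posterior mean of `θ` is `c w̄` with `c = nτ² / (1 + nτ²)`. The
Bayes rule therefore projects `m₀ + c A w̄`, whereas the sample average rule projects `m₀ + A w̄`.
Projection onto a box acts coordinatewise, and in coordinate `i` the two results agree unless `(A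
w̄) i` lies in a fixed bounded interval. If row `i` of `A` is nonzero, this has probability
`O(1/τ)`, and the excess cost there is at most `((1 - c) (A w̄) i)² / 2 = O(τ⁻⁴)`; a zero row
contributes nothing. The sample average rule thus exceeds the Bayes risk by `O(τ⁻⁵)` in every
dimension (`clampReal_excess_le`, `integral_slab_le`).

The Bayes risk of `δ` is no larger, so by strong convexity the mean squared distance between the two
rules is `O(τ⁻⁵)` as well (`integral_norm_sub_clamp_sq_le`). Since `N(0, I) ≤ τ^d N(0, τ² I)`, that
distance under the fixed prior `N(0, I)` is `O(τ^(d - 5))`, which tends to `0` when `d ≤ 4`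
(`ae_eq_zero_of_lintegral_le`). Hence the rules agree almost surely in state `m₀`, and their risks
there are equal. -/

/-! ### Comparison of finite product measures -/

namespace MeasureTheory.Measure

theorem pi_mono {ι : Type*} [Fintype ι] {α : ι → Type*} [∀ i, MeasurableSpace (α i)]
    {μ ν : ∀ i, Measure (α i)} [∀ i, SigmaFinite (μ i)] (h : ∀ i, μ i ≤ ν i) :
    Measure.pi μ ≤ Measure.pi ν := by
  -- `OuterMeasure.pi` is the largest outer measure bounded on boxes by the product of the side
  -- measures, so testing on boxes suffices.
  have key : (Measure.pi μ).toOuterMeasure ≤ OuterMeasure.pi fun i => (ν i).toOuterMeasure := by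
    rw [OuterMeasure.le_pi]
    intro s _
    change Measure.pi μ (Set.univ.pi s) ≤ _
    rw [Measure.pi_pi]
    exact Finset.prod_le_prod' fun i _ => h i (s i)
  refine Measure.le_iff.2 fun s hs => ?_
  calc Measure.pi μ s ≤ (OuterMeasure.pi fun i => (ν i).toOuterMeasure) s := key s
    _ = Measure.pi ν s := by rw [Measure.pi, toMeasure_apply _ _ hs]

theorem pi_const_smul {ι : Type*} [Fintype ι] {α : Type*} [MeasurableSpace α]
    {μ : Measure α} [IsFiniteMeasure μ] {c : ENNReal} (hc : c ≠ ⊤) :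
    Measure.pi (fun _ : ι => c • μ) = c ^ Fintype.card ι • Measure.pi (fun _ : ι => μ) := by
  have : IsFiniteMeasure (c • μ) := Measure.smul_finite μ hc
  refine Measure.pi_eq fun s _ => ?_
  simp [Measure.smul_apply, Measure.pi_pi, Finset.prod_mul_distrib]

theorem AbsolutelyContinuous.pi_fin {α : Type*} [MeasurableSpace α] :
    ∀ {n : ℕ} {μ ν : Fin n → Measure α} [∀ i, IsFiniteMeasure (μ i)] [∀ i, IsFiniteMeasure (ν i)],
      (∀ i, μ i ≪ ν i) → Measure.pi μ ≪ Measure.pi ν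
  | 0, μ, ν, _, _, _ => by
    rw [Measure.pi_of_empty μ (fun i => i.elim0), Measure.pi_of_empty ν (fun i => i.elim0)]
  | n + 1, μ, ν, _, _, h => by
    have hμ := (measurePreserving_piFinSuccAbove μ 0).symm
    have hν := (measurePreserving_piFinSuccAbove ν 0).symm
    rw [← hμ.map_eq, ← hν.map_eq]
    exact ((h 0).prod (AbsolutelyContinuous.pi_fin fun i => h (Fin.succAbove 0 i))).map
      (MeasurableEquiv.measurable _)

end MeasureTheory.Measure

/-! ### Gaussian measures: scaling, translation, slabs -/

namespace ProbabilityTheory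

theorem gaussianReal_absolutelyContinuous_gaussianReal (a b : ℝ) :
    gaussianReal a 1 ≪ gaussianReal b 1 :=
  (gaussianReal_absolutelyContinuous a one_ne_zero).trans
    (gaussianReal_absolutelyContinuous' b one_ne_zero)

/-- The factor `τ` cancels the change of normalising constant, and the wider Gaussian has the larger
exponential. -/
theorem gaussianReal_le_smul_gaussianReal {τ : ℝ} (hτ : 1 ≤ τ) :
    gaussianReal 0 1 ≤ ENNReal.ofReal τ • gaussianReal 0 (τ ^ 2).toNNReal := by
  have hτ0 : 0 < τ := by linarith
  rw [gaussianReal_of_var_ne_zero 0 one_ne_zero,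
    gaussianReal_of_var_ne_zero 0 (v := (τ ^ 2).toNNReal) (by simpa using hτ0.ne'),
    ← withDensity_smul _ (measurable_gaussianPDF _ _)]
  refine withDensity_mono (Filter.Eventually.of_forall fun x => ?_)
  simp only [Pi.smul_apply, smul_eq_mul, gaussianPDF]
  rw [← ENNReal.ofReal_mul hτ0.le]
  refine ENNReal.ofReal_le_ofReal ?_
  have hs : √(2 * Real.pi * τ ^ 2) = √(2 * Real.pi) * τ := by
    rw [Real.sqrt_mul (by positivity), Real.sqrt_sq hτ0.le]
  simp only [gaussianPDFReal, NNReal.coe_one, mul_one, sub_zero, Real.coe_toNNReal _ (sq_nonneg τ),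
    hs]
  have h1 : τ * ((√(2 * Real.pi) * τ)⁻¹ * Real.exp (-x ^ 2 / (2 * τ ^ 2))) =
      (√(2 * Real.pi))⁻¹ * Real.exp (-x ^ 2 / (2 * τ ^ 2)) := by
    field_simp
  rw [h1]
  gcongr _ * Real.exp ?_
  rw [div_le_div_iff₀ (by positivity) (by positivity)]
  nlinarith [sq_nonneg x, mul_nonneg (sq_nonneg x) (by nlinarith : (0:ℝ) ≤ τ ^ 2 - 1)]

variable {d n : ℕ}

/-- One factor `τ` per coordinate. This `τ ^ d` is the price of passing from the diffuse prior to a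
fixed one, and the only place where the dimension affects the rate. -/
theorem stdGaussian_le_smul_map {τ : ℝ} (hτ : 1 ≤ τ) :
    stdGaussian (EuclideanSpace ℝ (Fin d)) ≤ ENNReal.ofReal τ ^ d •
      (stdGaussian (EuclideanSpace ℝ (Fin d))).map (τ • ·) := by
  have h1 : Measure.pi (fun _ : Fin d => gaussianReal 0 1) ≤
      ENNReal.ofReal τ ^ d • (Measure.pi fun _ : Fin d => gaussianReal 0 1).map (τ • ·) := by
    have hm : (Measure.pi fun _ : Fin d => gaussianReal 0 1).map (τ • ·) =
        Measure.pi fun _ : Fin d => gaussianReal 0 (τ ^ 2).toNNReal := by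
      have := Measure.pi_map_pi (μ := fun _ : Fin d => gaussianReal 0 1)
        (f := fun _ x => τ * x) (fun _ => by fun_prop)
      simp only [gaussianReal_map_const_mul, mul_zero, mul_one] at this
      rw [Real.toNNReal_of_nonneg (sq_nonneg τ)]
      exact this
    rw [hm]
    have := Measure.pi_const_smul (ι := Fin d) (μ := gaussianReal 0 (τ ^ 2).toNNReal)
      (c := ENNReal.ofReal τ) ENNReal.ofReal_ne_top
    rw [Fintype.card_fin] at this
    rw [← this]
    exact Measure.pi_mono fun _ => gaussianReal_le_smul_gaussianReal hτ
  have h2 := Measure.map_mono h1 (f := WithLp.toLp 2) (by fun_prop)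
  rw [Measure.map_smul, Measure.map_map (by fun_prop) (by fun_prop), map_pi_eq_stdGaussian] at h2
  refine h2.trans_eq ?_
  rw [← map_pi_eq_stdGaussian, Measure.map_map (by fun_prop) (by fun_prop)]
  rfl

theorem map_const_add_stdGaussian_absolutelyContinuous (θ : EuclideanSpace ℝ (Fin d)) :
    (stdGaussian (EuclideanSpace ℝ (Fin d))).map (θ + ·) ≪
      stdGaussian (EuclideanSpace ℝ (Fin d)) := by
  have h : Measure.pi (fun i : Fin d => gaussianReal (θ i) 1) ≪
      Measure.pi fun _ : Fin d => gaussianReal 0 1 :=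
    Measure.AbsolutelyContinuous.pi_fin fun i =>
      gaussianReal_absolutelyContinuous_gaussianReal _ _
  have hm : (Measure.pi fun _ : Fin d => gaussianReal 0 1).map (fun x i => θ i + x i) =
      Measure.pi fun i : Fin d => gaussianReal (θ i) 1 := by
    have := Measure.pi_map_pi (μ := fun _ : Fin d => gaussianReal 0 1)
      (f := fun i x => θ i + x) (fun _ => by fun_prop)
    simpa [gaussianReal_map_const_add] using this
  have h2 := h.map (f := WithLp.toLp 2) (by fun_prop)
  rw [← hm, Measure.map_map (by fun_prop) (by fun_prop), map_pi_eq_stdGaussian] at h2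
  refine Measure.AbsolutelyContinuous.trans (Measure.absolutelyContinuous_of_eq ?_) h2
  rw [← map_pi_eq_stdGaussian, Measure.map_map (by fun_prop) (by fun_prop)]
  rfl

theorem map_const_add_pi_stdGaussian_absolutelyContinuous (θ : EuclideanSpace ℝ (Fin d)) :
    (Measure.pi fun _ : Fin n => stdGaussian (EuclideanSpace ℝ (Fin d))).map
      (fun z i => θ + z i) ≪ Measure.pi fun _ : Fin n => stdGaussian (EuclideanSpace ℝ (Fin d)) := by
  rw [Measure.pi_map_pi (f := fun _ x => θ + x) (fun _ => by fun_prop)]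
  exact Measure.AbsolutelyContinuous.pi_fin fun i =>
    map_const_add_stdGaussian_absolutelyContinuous θ

/-- Translated Gaussians are absolutely continuous with respect to each other, so an almost sure
statement in one state `θ` carries over to all of them. -/
theorem ae_pi_stdGaussian_const_add (θ : EuclideanSpace ℝ (Fin d))
    {p : (Fin n → EuclideanSpace ℝ (Fin d)) → Prop}
    (h : ∀ᵐ w ∂(Measure.pi fun _ : Fin n => stdGaussian (EuclideanSpace ℝ (Fin d))), p w) :
    ∀ᵐ z ∂(Measure.pi fun _ : Fin n => stdGaussian (EuclideanSpace ℝ (Fin d))),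
      p fun i => θ + z i := by
  have hm : Measurable fun (z : Fin n → EuclideanSpace ℝ (Fin d)) i => θ + z i := by fun_prop
  exact ae_of_ae_map hm.aemeasurable
    ((map_const_add_pi_stdGaussian_absolutelyContinuous θ).ae_le h)

theorem gaussianReal_Icc_le {v : NNReal} (hv : v ≠ 0) (p K : ℝ) :
    gaussianReal 0 v {x | |x + p| ≤ K} ≤ ENNReal.ofReal (K / √v) := by
  have hv0 : 0 < √(v : ℝ) := Real.sqrt_pos.2 (by positivity)
  have hset : {x | |x + p| ≤ K} = Set.Icc (-K - p) (K - p) := by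
    ext x
    simp only [Set.mem_ofPred_eq, Set.mem_Icc, abs_le]
    constructor <;> rintro ⟨h1, h2⟩ <;> constructor <;> linarith
  rw [hset, gaussianReal_apply 0 hv]
  -- The density is at most `1 / √(2πv)`, and `√(2π) ≥ 2`; the interval has length `2 K`.
  have hb : ∀ x, gaussianPDF 0 v x ≤ ENNReal.ofReal (1 / (2 * √v)) := by
    intro x
    refine ENNReal.ofReal_le_ofReal ?_
    have h2 : 2 * √(v : ℝ) ≤ √(2 * Real.pi * v) := by
      rw [Real.sqrt_mul (by positivity)]
      gcongr
      refine Real.le_sqrt_of_sq_le ?_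
      linarith [Real.pi_gt_three]
    have hexp : Real.exp (-(x - 0) ^ 2 / (2 * v)) ≤ 1 := by
      rw [Real.exp_le_one_iff]
      exact div_nonpos_of_nonpos_of_nonneg (by nlinarith [sq_nonneg (x - 0)]) (by positivity)
    calc gaussianPDFReal 0 v x ≤ (√(2 * Real.pi * v))⁻¹ * 1 := by
          rw [gaussianPDFReal]; gcongr
      _ ≤ 1 / (2 * √v) := by
          rw [mul_one, one_div]; gcongr
  calc ∫⁻ x in Set.Icc (-K - p) (K - p), gaussianPDF 0 v x
      ≤ ∫⁻ _ in Set.Icc (-K - p) (K - p), ENNReal.ofReal (1 / (2 * √v)) :=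
        lintegral_mono fun x => hb x
    _ = ENNReal.ofReal (K / √v) := by
        rw [setLIntegral_const, Real.volume_Icc, ← ENNReal.ofReal_mul (by positivity)]
        congr 1
        field_simp
        ring

theorem map_smul_stdGaussian_slab_le {τ : ℝ} (hτ : 0 < τ) {a : EuclideanSpace ℝ (Fin d)}
    (ha : a ≠ 0) (p K : ℝ) :
    (stdGaussian (EuclideanSpace ℝ (Fin d))).map (τ • ·) {θ | |inner ℝ a θ + p| ≤ K} ≤
      ENNReal.ofReal (K / (‖a‖ * τ)) := by
  have hL := IsGaussian.map_eq_gaussianReal (μ := stdGaussian (EuclideanSpace ℝ (Fin d)))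
    (innerSL ℝ (τ • a))
  rw [integral_strongDual_stdGaussian, variance_dual_stdGaussian, innerSL_apply_norm] at hL
  have hms : MeasurableSet {x : ℝ | |x + p| ≤ K} :=
    measurableSet_le (by fun_prop) (by fun_prop)
  have h1 : (stdGaussian (EuclideanSpace ℝ (Fin d))).map (τ • ·) {θ | |inner ℝ a θ + p| ≤ K} =
      gaussianReal 0 (‖τ • a‖ ^ 2).toNNReal {x | |x + p| ≤ K} := by
    rw [← hL, Measure.map_apply (by fun_prop) hms, Measure.map_apply (by fun_prop)
      (measurableSet_le (by fun_prop) (by fun_prop))]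
    congr 1
    ext x
    simp [inner_smul_right]
  have hne : (‖τ • a‖ ^ 2).toNNReal ≠ 0 := by
    have : τ • a ≠ 0 := smul_ne_zero hτ.ne' ha
    simpa using norm_pos_iff.2 this
  rw [h1]
  refine (gaussianReal_Icc_le hne p K).trans_eq ?_
  rw [Real.coe_toNNReal _ (sq_nonneg _), Real.sqrt_sq (norm_nonneg _), norm_smul,
    Real.norm_of_nonneg hτ.le, mul_comm]

end ProbabilityTheory

/-! ### The posterior mean via a reflection symmetry -/

namespace ProbabilityTheory

variable {E : Type*} [NormedAddCommGroup E] [InnerProductSpace ℝ E]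

/-- The reflection `(θ, z) ↦ (θ - 2 X, z + 2 X)`, where `X = θ - (c / n) ∑ i, (θ + z i)`. -/
noncomputable def posteriorReflection (n : ℕ) (c : ℝ) :
    (E × (Fin n → E)) →L[ℝ] (E × (Fin n → E)) :=
  let X : (E × (Fin n → E)) →L[ℝ] E := .fst ℝ E (Fin n → E) -
    (c / n) • ∑ i, (.fst ℝ E (Fin n → E) + .proj i ∘L .snd ℝ E (Fin n → E))
  (.fst ℝ E (Fin n → E) - (2 : ℝ) • X).prod
    (.pi fun i => .proj i ∘L .snd ℝ E (Fin n → E) + (2 : ℝ) • X)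

theorem posteriorReflection_fst (n : ℕ) (c : ℝ) (p : E × (Fin n → E)) :
    (posteriorReflection n c p).1 = p.1 - (2 : ℝ) • (p.1 - (c / n) • ∑ i, (p.1 + p.2 i)) := by
  simp [posteriorReflection]

theorem posteriorReflection_snd (n : ℕ) (c : ℝ) (p : E × (Fin n → E)) (i : Fin n) :
    (posteriorReflection n c p).2 i = p.2 i + (2 : ℝ) • (p.1 - (c / n) • ∑ i, (p.1 + p.2 i)) := by
  simp [posteriorReflection]

/-- The left side is the covariance form of `(θ, z)` evaluated on the transposed reflection. The
condition `hc` says that `θ - c w̄` is uncorrelated with each `w i`: the covariance is `τ² - c (τ² +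
1 / n)` times the identity. -/
theorem sum_norm_sq_reflection {n : ℕ} (hn : n ≠ 0) {τ c : ℝ} (hc : (1 - c) * τ ^ 2 = c / n)
    (x : E) (y : Fin n → E) :
    τ ^ 2 * ‖x - (2 * (1 - c)) • (x - ∑ i, y i)‖ ^ 2 +
      ∑ j, ‖y j + (2 * (c / n)) • (x - ∑ i, y i)‖ ^ 2 = τ ^ 2 * ‖x‖ ^ 2 + ∑ j, ‖y j‖ ^ 2 := by
  have hn' : (n : ℝ) ≠ 0 := by exact_mod_cast hn
  set s := x - ∑ i, y i with hs
  have h1 : ∑ j, ‖y j + (2 * (c / n)) • s‖ ^ 2 = ∑ j, ‖y j‖ ^ 2 +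
      4 * (c / n) * inner ℝ (x - s) s + n * (2 * (c / n)) ^ 2 * ‖s‖ ^ 2 := by
    have hS : x - s = ∑ i, y i := by rw [hs]; abel
    rw [hS, sum_inner]
    simp_rw [norm_add_sq_real, inner_smul_right, norm_smul, mul_pow, Finset.sum_add_distrib,
      Real.norm_eq_abs, sq_abs]
    simp only [Finset.sum_const, Finset.card_univ, Fintype.card_fin, nsmul_eq_mul,
      ← Finset.mul_sum]
    ring
  rw [h1, norm_sub_sq_real, inner_smul_right, norm_smul, mul_pow, Real.norm_eq_abs, sq_abs,
    inner_sub_left, real_inner_self_eq_norm_sq]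
  have h2 : (n : ℝ) * (2 * (c / n)) ^ 2 = 4 * (c / n) * c := by field_simp; ring
  rw [h2]
  linear_combination (4 * (1 - c) * ‖s‖ ^ 2 - 4 * inner ℝ x s) * hc

variable [FiniteDimensional ℝ E] [MeasurableSpace E] [BorelSpace E]

theorem charFunDual_map_smul_stdGaussian (τ : ℝ) (L : StrongDual ℝ E) :
    charFunDual ((stdGaussian E).map (τ • ·)) L = Complex.exp (-(τ ^ 2 * ‖L‖ ^ 2 : ℝ) / 2) := by
  have : (τ • · : E → E) = (τ • ContinuousLinearMap.id ℝ E : E →L[ℝ] E) := rfl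
  rw [this, charFunDual_map, charFunDual_stdGaussian, ContinuousLinearMap.comp_smul,
    ContinuousLinearMap.comp_id, norm_smul, ← Complex.ofReal_pow, mul_pow,
    Real.norm_eq_abs, sq_abs]

instance isProbabilityMeasure_map_smul_stdGaussian (τ : ℝ) :
    IsProbabilityMeasure ((stdGaussian E).map (τ • ·)) :=
  Measure.isProbabilityMeasure_map (by fun_prop)

/-- A centred Gaussian law is determined by its covariance form, so comparing characteristic
functions reduces invariance to `sum_norm_sq_reflection`. -/
theorem map_posteriorReflection {n : ℕ} (hn : n ≠ 0) {τ c : ℝ}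
    (hc : (1 - c) * τ ^ 2 = c / n) :
    (((stdGaussian E).map (τ • ·)).prod (Measure.pi fun _ : Fin n => stdGaussian E)).map
      (posteriorReflection n c) =
    ((stdGaussian E).map (τ • ·)).prod (Measure.pi fun _ : Fin n => stdGaussian E) := by
  have hn' : (n : ℝ) ≠ 0 := by exact_mod_cast hn
  apply Measure.ext_of_charFunDual
  ext L
  have key : ∀ L : StrongDual ℝ (E × (Fin n → E)),
      charFunDual (((stdGaussian E).map (τ • ·)).prod
        (Measure.pi fun _ : Fin n => stdGaussian E)) L =
      Complex.exp (-(τ ^ 2 * ‖L ∘L .inl ℝ E (Fin n → E)‖ ^ 2 +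
        ∑ j, ‖(L ∘L .inr ℝ E (Fin n → E)) ∘L .single ℝ (fun _ : Fin n => E) j‖ ^ 2 : ℝ) / 2) := by
    intro L
    rw [charFunDual_prod, charFunDual_pi, charFunDual_map_smul_stdGaussian]
    simp_rw [charFunDual_stdGaussian]
    rw [← Complex.exp_sum, ← Complex.exp_add]
    congr 1
    push_cast
    rw [neg_add, add_div, ← Finset.sum_neg_distrib, Finset.sum_div]
  rw [charFunDual_map, key, key]
  congr 4
  set e := (InnerProductSpace.toDual ℝ E).symm
  set x := e (L ∘L .inl ℝ E (Fin n → E)) with hx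
  set y : Fin n → E := fun j =>
    e ((L ∘L .inr ℝ E (Fin n → E)) ∘L .single ℝ (fun _ : Fin n => E) j) with hy
  have hxv : ∀ v, L (v, 0) = inner ℝ x v := fun v => by
    simp [hx, e, InnerProductSpace.toDual_symm_apply]
  have hyv : ∀ j v, L (0, Pi.single j v) = inner ℝ (y j) v := fun j v => by
    simp [hy, e, InnerProductSpace.toDual_symm_apply]
  have hL : ∀ p : E × (Fin n → E), L p = inner ℝ x p.1 + ∑ j, inner ℝ (y j) (p.2 j) := by
    intro p
    simp_rw [← hxv, ← hyv]
    rw [← map_sum, ← map_add]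
    congr 1
    refine Prod.ext (by simp [Prod.fst_sum]) ?_
    simp [Prod.snd_sum, Finset.univ_sum_single]
  have h1 : (L ∘L posteriorReflection n c) ∘L .inl ℝ E (Fin n → E) =
      InnerProductSpace.toDual ℝ E (x - (2 * (1 - c)) • (x - ∑ i, y i)) := by
    ext v
    simp only [ContinuousLinearMap.comp_apply, ContinuousLinearMap.inl_apply, hL,
      posteriorReflection_fst, posteriorReflection_snd, InnerProductSpace.toDual_apply_apply]
    simp only [Pi.zero_apply, add_zero, zero_add, Finset.sum_const, Finset.card_univ,
      Fintype.card_fin, inner_sub_left, inner_sub_right, inner_smul_right, inner_smul_left,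
      sum_inner, ← Nat.cast_smul_eq_nsmul ℝ, ← Finset.mul_sum, conj_trivial,
      Finset.sum_sub_distrib]
    field_simp
    ring
  have h2 : ∀ j, ((L ∘L posteriorReflection n c) ∘L .inr ℝ E (Fin n → E)) ∘L
      .single ℝ (fun _ : Fin n => E) j =
      InnerProductSpace.toDual ℝ E (y j + (2 * (c / n)) • (x - ∑ i, y i)) := by
    intro j
    ext v
    simp only [ContinuousLinearMap.comp_apply, ContinuousLinearMap.inr_apply, hL,
      ContinuousLinearMap.single_apply,
      posteriorReflection_fst, posteriorReflection_snd, InnerProductSpace.toDual_apply_apply]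
    simp only [zero_add, inner_add_right, zero_sub, inner_neg_right,
      inner_add_left, inner_sub_left, inner_smul_right, inner_smul_left,
      sum_inner, ← Finset.mul_sum, conj_trivial, Finset.sum_add_distrib, smul_neg,
      Finset.sum_neg_distrib]
    have h3 : ∑ i, (Pi.single j v : Fin n → E) i = v := by simp
    have : ∑ i, inner ℝ (y i) ((Pi.single j v : Fin n → E) i) = inner ℝ (y j) v := by
      rw [Finset.sum_eq_single j] <;> simp +contextual
    simp only [this, h3]
    ring
  have h3 : ‖L ∘L .inl ℝ E (Fin n → E)‖ = ‖x‖ := by rw [hx, LinearIsometryEquiv.norm_map]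
  have h4 : ∀ j, ‖(L ∘L .inr ℝ E (Fin n → E)) ∘L .single ℝ (fun _ : Fin n => E) j‖ = ‖y j‖ :=
    fun j => by rw [hy, LinearIsometryEquiv.norm_map]
  simp_rw [h1, h2, h3, h4, LinearIsometryEquiv.norm_map]
  exact sum_norm_sq_reflection hn hc x y

/-- The posterior mean of `θ ∼ N(0, τ² I)` given `w i = θ + z i` is `(c / n) ∑ i, w i`: the error
`θ - (c / n) ∑ i, w i` is orthogonal to every function of `w`. -/
theorem integral_inner_sub_posteriorMean_eq_zero {n : ℕ} (hn : n ≠ 0) {τ c : ℝ}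
    (hc : (1 - c) * τ ^ 2 = c / n) {ψ : (Fin n → E) → E} (hψ : Measurable ψ) :
    ∫ p : E × (Fin n → E), inner ℝ (p.1 - (c / n) • ∑ i, (p.1 + p.2 i)) (ψ fun i => p.1 + p.2 i)
      ∂((stdGaussian E).map (τ • ·)).prod (Measure.pi fun _ : Fin n => stdGaussian E) = 0 := by
  set P := ((stdGaussian E).map (τ • ·)).prod (Measure.pi fun _ : Fin n => stdGaussian E)
  set f : E × (Fin n → E) → ℝ := fun p =>
    inner ℝ (p.1 - (c / n) • ∑ i, (p.1 + p.2 i)) (ψ fun i => p.1 + p.2 i)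
  have hf : Measurable f := by
    refine Measurable.inner (by fun_prop) (hψ.comp ?_)
    fun_prop
  -- The reflection fixes every `w i` and negates the error, so the integrand is odd under a
  -- measure-preserving map. No integrability is needed.
  have hw : ∀ p : E × (Fin n → E), ∀ i,
      (posteriorReflection n c p).1 + (posteriorReflection n c p).2 i = p.1 + p.2 i := by
    intro p i
    rw [posteriorReflection_fst, posteriorReflection_snd]
    abel
  have hodd : ∀ p, f (posteriorReflection n c p) = - f p := by
    intro p
    simp only [f, hw]
    rw [← inner_neg_left, posteriorReflection_fst]
    congr 1
    module
  have h1 : ∫ p, f p ∂P = - ∫ p, f p ∂P := by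
    have hP : P.map (posteriorReflection n c) = P := map_posteriorReflection hn hc
    conv_lhs => rw [← hP]
    rw [integral_map (by fun_prop) hf.aestronglyMeasurable, ← integral_neg]
    exact integral_congr_ae (Filter.Eventually.of_forall hodd)
  linarith

end ProbabilityTheory

/-! ### Projection onto the box and the quadratic cost -/

namespace StochOpt

/-- Truncation of a real number to `[a, b]`. -/
def clampReal (a b x : ℝ) : ℝ := max a (min b x)

theorem clampReal_mem {a b : ℝ} (hab : a ≤ b) (x : ℝ) :
    a ≤ clampReal a b x ∧ clampReal a b x ≤ b :=
  ⟨le_max_left _ _, max_le hab (min_le_left _ _)⟩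

theorem clampReal_variational {a b : ℝ} (x : ℝ) {t : ℝ} (ht : a ≤ t ∧ t ≤ b) :
    0 ≤ (clampReal a b x - x) * (t - clampReal a b x) := by
  unfold clampReal
  obtain ⟨h1, h2⟩ := ht
  rcases le_total b x with h | h
  · rw [min_eq_left h, max_eq_right (h1.trans h2)]
    nlinarith
  · rw [min_eq_right h]
    rcases le_total a x with h' | h'
    · rw [max_eq_right h']; simp
    · rw [max_eq_left h']; nlinarith

theorem clampReal_of_le {a b x : ℝ} (hab : a ≤ b) (h : b ≤ x) : clampReal a b x = b := by
  rw [clampReal, min_eq_left h, max_eq_right hab]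

theorem clampReal_of_ge {a b x : ℝ} (h : x ≤ a) : clampReal a b x = a :=
  max_eq_left ((min_le_right _ _).trans h)

/-- Excess cost incurred when the target `m + c t` is replaced by `m + t` before truncation. -/
theorem clampReal_excess_le {a b : ℝ} (hab : a ≤ b) (m t : ℝ) {c : ℝ} (hc : 1 / 2 ≤ c) :
    (1 / 2 * clampReal a b (m + t) ^ 2 - (m + c * t) * clampReal a b (m + t)) -
      (1 / 2 * clampReal a b (m + c * t) ^ 2 - (m + c * t) * clampReal a b (m + c * t)) ≤
    1 / 2 * ((1 - c) * t) ^ 2 * if |t| ≤ 2 * (|m| + |a| + |b|) then 1 else 0 := by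
  split_ifs with ht
  · have := clampReal_variational (m + t) (clampReal_mem hab (m + c * t))
    set p := clampReal a b (m + t)
    set q := clampReal a b (m + c * t)
    -- With `s = (1 - c) t`, the variational inequality bounds the excess by `s (p - q) - (p - q)² /
    -- 2`, which is at most `s² / 2`.
    nlinarith [sq_nonneg ((1 - c) * t - (p - q))]
  · have hm := abs_le.1 (le_refl |m|)
    have ha := abs_le.1 (le_refl |a|)
    have hb := abs_le.1 (le_refl |b|)
    -- As `c ≥ 1 / 2`, both `|t|` and `|c t|` are at least `|m| + |a| + |b|`, so both targets lie
    -- beyond the same end of `[a, b]`.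
    have heq : clampReal a b (m + t) = clampReal a b (m + c * t) := by
      push Not at ht
      rcases le_total 0 t with h0 | h0
      · rw [abs_of_nonneg h0] at ht
        have : |m| + |a| + |b| ≤ c * t := by nlinarith
        rw [clampReal_of_le hab, clampReal_of_le hab] <;> nlinarith [abs_nonneg a]
      · rw [abs_of_nonpos h0] at ht
        have : c * t ≤ -(|m| + |a| + |b|) := by nlinarith
        rw [clampReal_of_ge, clampReal_of_ge] <;> nlinarith [abs_nonneg b]
    rw [heq]; simp

variable {d : ℕ}

/-- The Euclidean projection onto the box. -/
def clamp (l u : Fin d → ℝ) (x : EuclideanSpace ℝ (Fin d)) : EuclideanSpace ℝ (Fin d) :=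
  WithLp.toLp 2 fun i => clampReal (l i) (u i) (x i)

theorem clamp_apply (l u : Fin d → ℝ) (x : EuclideanSpace ℝ (Fin d)) (i : Fin d) :
    clamp l u x i = clampReal (l i) (u i) (x i) := rfl

theorem clamp_mem_box {l u : Fin d → ℝ} (hlu : ∀ i, l i ≤ u i) (x : EuclideanSpace ℝ (Fin d)) : clamp l u x ∈ box l u :=
  fun i => clampReal_mem (hlu i) (x i)

theorem continuous_clamp (l u : Fin d → ℝ) : Continuous (clamp l u) := by
  unfold clamp clampReal
  fun_prop

theorem quadCost_eq_sum (x ξ : EuclideanSpace ℝ (Fin d)) :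
    quadCost x ξ = ∑ i, (1 / 2 * x i ^ 2 - ξ i * x i) := by
  rw [quadCost, EuclideanSpace.real_norm_sq_eq, PiLp.inner_apply, Finset.mul_sum,
    ← Finset.sum_sub_distrib]
  simp [mul_comm]

theorem quadCost_clamp_add_le (l u : Fin d → ℝ) (m : EuclideanSpace ℝ (Fin d)) {x : EuclideanSpace ℝ (Fin d)}
    (hx : x ∈ box l u) :
    quadCost (clamp l u m) m + 1 / 2 * ‖x - clamp l u m‖ ^ 2 ≤ quadCost x m := by
  rw [quadCost_eq_sum, quadCost_eq_sum, EuclideanSpace.real_norm_sq_eq, Finset.mul_sum,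
    ← Finset.sum_add_distrib]
  refine Finset.sum_le_sum fun i _ => ?_
  have := clampReal_variational (m i) (hx i)
  simp only [PiLp.sub_apply, clamp_apply]
  nlinarith

theorem isArgmin_quadCost_iff {l u : Fin d → ℝ} (hlu : ∀ i, l i ≤ u i) (m z : EuclideanSpace ℝ (Fin d)) :
    IsArgmin (fun x => quadCost x m) (box l u) z ↔ z = clamp l u m := by
  constructor
  · rintro ⟨hz, hmin⟩
    have h1 := quadCost_clamp_add_le l u m hz
    have h2 := hmin _ (clamp_mem_box hlu m)
    have h3 : ‖z - clamp l u m‖ ^ 2 ≤ 0 := by simp only at h2; linarith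
    have h4 : ‖z - clamp l u m‖ = 0 := by nlinarith [norm_nonneg (z - clamp l u m)]
    exact sub_eq_zero.1 (norm_eq_zero.1 h4)
  · rintro rfl
    refine ⟨clamp_mem_box hlu m, fun x hx => ?_⟩
    have := quadCost_clamp_add_le l u m hx
    have := sq_nonneg ‖x - clamp l u m‖
    simp only
    linarith

theorem sampleAverage_eq_quadCost {n : ℕ} (hn : n ≠ 0) (y : Fin n → EuclideanSpace ℝ (Fin d)) (x : EuclideanSpace ℝ (Fin d)) :
    (1 / (n : ℝ)) * ∑ i, quadCost x (y i) = quadCost x (sampleMean y) := by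
  have hn' : (n : ℝ) ≠ 0 := by exact_mod_cast hn
  simp only [quadCost, sampleMean, Finset.sum_sub_distrib, inner_smul_left, sum_inner,
    Finset.sum_const, Finset.card_univ, Fintype.card_fin, nsmul_eq_mul, conj_trivial]
  field_simp

theorem isSampleAverageRule_iff {l u : Fin d → ℝ} (hlu : ∀ i, l i ≤ u i) {n : ℕ} (hn : n ≠ 0)
    (δ : (Fin n → EuclideanSpace ℝ (Fin d)) → EuclideanSpace ℝ (Fin d)) :
    IsSampleAverageRule quadCost (box l u) n δ ↔ δ = fun y => clamp l u (sampleMean y) := by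
  simp only [IsSampleAverageRule, sampleAverage_eq_quadCost hn, isArgmin_quadCost_iff hlu,
    funext_iff]

theorem norm_sub_sq_eq_quadCost (m x : EuclideanSpace ℝ (Fin d)) :
    ‖m - x‖ ^ 2 = ‖m‖ ^ 2 + 2 * quadCost x m := by
  rw [norm_sub_sq_real, quadCost]; ring

theorem isArgmin_norm_sub_clamp {l u : Fin d → ℝ} (hlu : ∀ i, l i ≤ u i) (m : EuclideanSpace ℝ (Fin d)) :
    IsArgmin (fun x => ‖m - x‖) (box l u) (clamp l u m) := by
  obtain ⟨h1, h2⟩ := (isArgmin_quadCost_iff hlu m _).2 rfl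
  refine ⟨h1, fun x hx => ?_⟩
  have := h2 x hx
  refine (sq_le_sq₀ (norm_nonneg _) (norm_nonneg _)).1 ?_
  rw [norm_sub_sq_eq_quadCost, norm_sub_sq_eq_quadCost]
  simp only at this
  linarith

theorem norm_le_of_mem_box {l u : Fin d → ℝ} {x : EuclideanSpace ℝ (Fin d)} (hx : x ∈ box l u) :
    ‖x‖ ≤ ∑ i, (|l i| + |u i|) := by
  have h : ‖x‖ ≤ ∑ i, |x i| := by
    refine (sq_le_sq₀ (norm_nonneg _) (by positivity)).1 ?_
    rw [EuclideanSpace.real_norm_sq_eq]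
    simpa using Finset.sum_sq_le_sq_sum_of_nonneg (s := Finset.univ) (f := fun i => |x i|)
      (fun i _ => abs_nonneg _)
  refine h.trans (Finset.sum_le_sum fun i _ => abs_le.2 ⟨?_, ?_⟩)
  · linarith [(hx i).1, neg_abs_le (l i), abs_nonneg (u i)]
  · linarith [(hx i).2, le_abs_self (u i), abs_nonneg (l i)]

/-- The loss of a rule compared with the projection of a shrunken target. -/
theorem norm_sub_sq_le {l u : Fin d → ℝ} (hlu : ∀ i, l i ≤ u i) (m₀ t : EuclideanSpace ℝ (Fin d)) {c : ℝ}
    (hc : 1 / 2 ≤ c) {x : EuclideanSpace ℝ (Fin d)} (hx : x ∈ box l u) :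
    ‖x - clamp l u (m₀ + t)‖ ^ 2 ≤
      4 * (quadCost x (m₀ + c • t) - quadCost (clamp l u (m₀ + t)) (m₀ + c • t)) +
      8 * ∑ i, 1 / 2 * ((1 - c) * t i) ^ 2 *
        if |t i| ≤ 2 * (|m₀ i| + |l i| + |u i|) then 1 else 0 := by
  set m := m₀ + c • t
  set q := clamp l u m
  set p := clamp l u (m₀ + t)
  have h1 : quadCost p m - quadCost q m ≤ ∑ i, 1 / 2 * ((1 - c) * t i) ^ 2 *
        if |t i| ≤ 2 * (|m₀ i| + |l i| + |u i|) then 1 else 0 := by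
    rw [quadCost_eq_sum, quadCost_eq_sum, ← Finset.sum_sub_distrib]
    exact Finset.sum_le_sum fun i _ => clampReal_excess_le (hlu i) (m₀ i) (t i) hc
  -- Strong convexity at the minimiser `q` bounds both `‖x - q‖²` and `‖p - q‖²` by twice a cost
  -- gap. Rewriting the gap of `x` relative to `p` instead of `q` turns the constants `4, 4` into
  -- `4, 8`.
  have h2 := quadCost_clamp_add_le l u m hx
  have h3 := quadCost_clamp_add_le l u m (clamp_mem_box hlu (m₀ + t))
  have h4 : ‖x - p‖ ^ 2 ≤ 2 * ‖x - q‖ ^ 2 + 2 * ‖p - q‖ ^ 2 := by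
    have h5 : ‖x - p‖ ≤ ‖x - q‖ + ‖p - q‖ := by
      rw [norm_sub_rev p q]; exact norm_sub_le_norm_sub_add_norm_sub x q p
    nlinarith [norm_nonneg (x - p), sq_nonneg (‖x - q‖ - ‖p - q‖)]
  linarith

end StochOpt

/-! ### Slab estimates under the Bayesian model -/

namespace StochOpt

variable {d n : ℕ}

theorem sampleMean_const_add (hn : n ≠ 0) (θ : EuclideanSpace ℝ (Fin d))
    (z : Fin n → EuclideanSpace ℝ (Fin d)) :
    sampleMean (fun i => θ + z i) = θ + sampleMean z := by
  have hn' : (n : ℝ) ≠ 0 := by exact_mod_cast hn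
  simp only [sampleMean, Finset.sum_add_distrib, Finset.sum_const, Finset.card_univ,
    Fintype.card_fin, ← Nat.cast_smul_eq_nsmul ℝ, smul_add, smul_smul]
  rw [one_div_mul_cancel hn', one_smul]

theorem continuous_sampleMean :
    Continuous (sampleMean : (Fin n → EuclideanSpace ℝ (Fin d)) → _) := by
  unfold sampleMean
  fun_prop

theorem sampleMean_affine (hn : n ≠ 0) (m : EuclideanSpace ℝ (Fin d))
    (A : EuclideanSpace ℝ (Fin d) →L[ℝ] EuclideanSpace ℝ (Fin d))
    (w : Fin n → EuclideanSpace ℝ (Fin d)) :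
    sampleMean (fun i => m + A (w i)) = m + A (sampleMean w) := by
  rw [sampleMean_const_add hn]
  simp [sampleMean]

theorem integrable_quadCost {Ω : Type*} [MeasurableSpace Ω] {P : Measure Ω} [IsFiniteMeasure P]
    {g M : Ω → EuclideanSpace ℝ (Fin d)} {C : ℝ} (hg : AEStronglyMeasurable g P)
    (hgC : ∀ ω, ‖g ω‖ ≤ C) (hM : Integrable M P) :
    Integrable (fun ω => quadCost (g ω) (M ω)) P := by
  unfold quadCost
  refine Integrable.sub ?_ ?_
  · refine Integrable.const_mul (Integrable.of_bound (by fun_prop) (C ^ 2)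
      (Filter.Eventually.of_forall fun ω => ?_)) _
    rw [Real.norm_of_nonneg (sq_nonneg _)]
    exact pow_le_pow_left₀ (norm_nonneg _) (hgC ω) 2
  · refine (hM.norm.mul_const C).mono' (hM.aestronglyMeasurable.inner hg)
      (Filter.Eventually.of_forall fun ω => ?_)
    exact (norm_inner_le_norm _ _).trans
      (mul_le_mul_of_nonneg_left (hgC ω) (norm_nonneg _))

theorem measurable_inner_sampleMean (a : EuclideanSpace ℝ (Fin d)) :
    Measurable fun p : EuclideanSpace ℝ (Fin d) × (Fin n → EuclideanSpace ℝ (Fin d)) =>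
      inner ℝ a (sampleMean fun i => p.1 + p.2 i) := by
  refine Continuous.measurable (continuous_const.inner (continuous_sampleMean.comp ?_))
  fun_prop

/-- For fixed `z` this is a slab in `θ` alone, and the one-dimensional bound is uniform in the shift
caused by `z`. -/
theorem slab_measure_le (hn : n ≠ 0) {a : EuclideanSpace ℝ (Fin d)} (ha : a ≠ 0) (K : ℝ) {τ : ℝ}
    (hτ : 0 < τ) :
    (((stdGaussian (EuclideanSpace ℝ (Fin d))).map (τ • ·)).prod
      (Measure.pi fun _ : Fin n => stdGaussian (EuclideanSpace ℝ (Fin d))))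
      {p | |inner ℝ a (sampleMean fun i => p.1 + p.2 i)| ≤ K} ≤
        ENNReal.ofReal (K / (‖a‖ * τ)) := by
  have hs : MeasurableSet {p : EuclideanSpace ℝ (Fin d) × (Fin n → EuclideanSpace ℝ (Fin d)) |
      |inner ℝ a (sampleMean fun i => p.1 + p.2 i)| ≤ K} :=
    measurableSet_le (measurable_inner_sampleMean a).abs measurable_const
  rw [Measure.prod_apply_symm hs]
  calc _ ≤ ∫⁻ _ : Fin n → EuclideanSpace ℝ (Fin d), ENNReal.ofReal (K / (‖a‖ * τ))
        ∂(Measure.pi fun _ : Fin n => stdGaussian (EuclideanSpace ℝ (Fin d))) := by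
        refine lintegral_mono fun z => ?_
        refine le_of_eq_of_le ?_ (map_smul_stdGaussian_slab_le hτ ha (inner ℝ a (sampleMean z)) K)
        congr 1
        ext θ
        simp [sampleMean_const_add hn, inner_add_right]
    _ = ENNReal.ofReal (K / (‖a‖ * τ)) := by simp

theorem integrable_slab (a : EuclideanSpace ℝ (Fin d)) (K τ c : ℝ) :
    Integrable (fun p : EuclideanSpace ℝ (Fin d) × (Fin n → EuclideanSpace ℝ (Fin d)) =>
      1 / 2 * ((1 - c) * inner ℝ a (sampleMean fun i => p.1 + p.2 i)) ^ 2 *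
        if |inner ℝ a (sampleMean fun i => p.1 + p.2 i)| ≤ K then (1 : ℝ) else 0)
      (((stdGaussian (EuclideanSpace ℝ (Fin d))).map (τ • ·)).prod
        (Measure.pi fun _ : Fin n => stdGaussian (EuclideanSpace ℝ (Fin d)))) := by
  have hm := measurable_inner_sampleMean (n := n) a
  refine Integrable.of_bound (C := 1 / 2 * ((1 - c) ^ 2 * K ^ 2)) ?_
    (Filter.Eventually.of_forall fun p => ?_)
  · refine (Measurable.mul (by fun_prop) (Measurable.ite ?_ measurable_const
      measurable_const)).aestronglyMeasurable
    exact measurableSet_le hm.abs measurable_const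
  · split_ifs with h
    · rw [mul_one, Real.norm_of_nonneg (by positivity), mul_pow]
      have := sq_le_sq' (abs_le.1 h).1 (abs_le.1 h).2
      gcongr
    · simp only [mul_zero, norm_zero]; positivity

theorem integral_slab_le (hn : n ≠ 0) (a : EuclideanSpace ℝ (Fin d)) {K τ c : ℝ} (hK : 0 ≤ K)
    (hτ : 0 < τ) (hc : 0 ≤ 1 - c) (hcτ : 1 - c ≤ 1 / τ ^ 2) :
    ∫ p : EuclideanSpace ℝ (Fin d) × (Fin n → EuclideanSpace ℝ (Fin d)),
      (1 / 2 * ((1 - c) * inner ℝ a (sampleMean fun i => p.1 + p.2 i)) ^ 2 *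
        if |inner ℝ a (sampleMean fun i => p.1 + p.2 i)| ≤ K then (1 : ℝ) else 0)
      ∂((stdGaussian (EuclideanSpace ℝ (Fin d))).map (τ • ·)).prod
        (Measure.pi fun _ : Fin n => stdGaussian (EuclideanSpace ℝ (Fin d))) ≤
      K ^ 3 / (2 * ‖a‖) / τ ^ 5 := by
  rcases eq_or_ne a 0 with rfl | ha
  -- Here the integrand vanishes, and the right side is `0` because division by zero gives `0`.
  · simp
  set P := ((stdGaussian (EuclideanSpace ℝ (Fin d))).map (τ • ·)).prod
    (Measure.pi fun _ : Fin n => stdGaussian (EuclideanSpace ℝ (Fin d)))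
  set s : Set (EuclideanSpace ℝ (Fin d) × (Fin n → EuclideanSpace ℝ (Fin d))) :=
    {p | |inner ℝ a (sampleMean fun i => p.1 + p.2 i)| ≤ K}
  have hs : MeasurableSet s :=
    measurableSet_le (measurable_inner_sampleMean a).abs measurable_const
  have ha' : 0 < ‖a‖ := norm_pos_iff.2 ha
  have hPs : P.real s ≤ K / (‖a‖ * τ) :=
    ENNReal.toReal_le_of_le_ofReal (by positivity) (slab_measure_le hn ha K hτ)
  have hle : ∀ p : EuclideanSpace ℝ (Fin d) × (Fin n → EuclideanSpace ℝ (Fin d)),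
      (1 / 2 * ((1 - c) * inner ℝ a (sampleMean fun i => p.1 + p.2 i)) ^ 2 *
        if |inner ℝ a (sampleMean fun i => p.1 + p.2 i)| ≤ K then (1 : ℝ) else 0) ≤
      s.indicator (fun _ => 1 / 2 * ((1 / τ ^ 2) ^ 2 * K ^ 2)) p := by
    intro p
    by_cases h : |inner ℝ a (sampleMean fun i => p.1 + p.2 i)| ≤ K
    · rw [if_pos h, Set.indicator_of_mem (show p ∈ s from h), mul_one, mul_pow]
      have := sq_le_sq' (abs_le.1 h).1 (abs_le.1 h).2
      gcongr
    · rw [if_neg h, Set.indicator_of_notMem (show p ∉ s from h), mul_zero]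
  calc _ ≤ ∫ p, s.indicator (fun _ => 1 / 2 * ((1 / τ ^ 2) ^ 2 * K ^ 2)) p ∂P :=
        integral_mono (integrable_slab a K τ c) ((integrable_const _).indicator hs) hle
    _ = P.real s * (1 / 2 * ((1 / τ ^ 2) ^ 2 * K ^ 2)) := by
        rw [integral_indicator_const _ hs, smul_eq_mul]
    _ ≤ K / (‖a‖ * τ) * (1 / 2 * ((1 / τ ^ 2) ^ 2 * K ^ 2)) := by gcongr
    _ = K ^ 3 / (2 * ‖a‖) / τ ^ 5 := by field_simp

theorem apply_eq_inner_adjoint (A : EuclideanSpace ℝ (Fin d) →L[ℝ] EuclideanSpace ℝ (Fin d))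
    (v : EuclideanSpace ℝ (Fin d)) (i : Fin d) :
    A v i = inner ℝ (A.adjoint (EuclideanSpace.single i (1 : ℝ))) v := by
  rw [ContinuousLinearMap.adjoint_inner_left, EuclideanSpace.inner_single_left]
  simp

end StochOpt

/-! ### Blyth's argument -/

namespace StochOpt

variable {d n : ℕ}

/-- If the projection of `m₀ + A w̄` has nowhere a smaller risk than `h`, then `h` is close to it
under the Bayesian model `θ ∼ N(0, τ² I)`, `w i = θ + z i`, at the rate `τ ^ (-5)`. -/
theorem integral_norm_sub_clamp_sq_le (hn : n ≠ 0) {l u : Fin d → ℝ} (hlu : ∀ i, l i ≤ u i)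
    (A : EuclideanSpace ℝ (Fin d) →L[ℝ] EuclideanSpace ℝ (Fin d)) (m₀ : EuclideanSpace ℝ (Fin d))
    {h : (Fin n → EuclideanSpace ℝ (Fin d)) → EuclideanSpace ℝ (Fin d)} (hm : Measurable h)
    (hbox : ∀ w, h w ∈ box l u)
    (hrisk : ∀ θ : EuclideanSpace ℝ (Fin d),
      ∫ z, quadCost (h fun i => θ + z i) (m₀ + A θ)
        ∂(Measure.pi fun _ : Fin n => stdGaussian (EuclideanSpace ℝ (Fin d))) ≤
      ∫ z, quadCost (clamp l u (m₀ + A (sampleMean fun i => θ + z i))) (m₀ + A θ)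
        ∂(Measure.pi fun _ : Fin n => stdGaussian (EuclideanSpace ℝ (Fin d))))
    {τ : ℝ} (hτ : 1 ≤ τ) :
    ∫ p : EuclideanSpace ℝ (Fin d) × (Fin n → EuclideanSpace ℝ (Fin d)),
      ‖h (fun i => p.1 + p.2 i) - clamp l u (m₀ + A (sampleMean fun i => p.1 + p.2 i))‖ ^ 2
      ∂((stdGaussian (EuclideanSpace ℝ (Fin d))).map (τ • ·)).prod
        (Measure.pi fun _ : Fin n => stdGaussian (EuclideanSpace ℝ (Fin d))) ≤
    (8 * ∑ i, (2 * (|m₀ i| + |l i| + |u i|)) ^ 3 /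
      (2 * ‖A.adjoint (EuclideanSpace.single i (1 : ℝ))‖)) / τ ^ 5 := by
  have hτ0 : 0 < τ := by linarith
  have hn1 : (1 : ℝ) ≤ n := by exact_mod_cast Nat.one_le_iff_ne_zero.2 hn
  have hn0 : (n : ℝ) ≠ 0 := by positivity
  have hden : 0 < 1 + n * τ ^ 2 := by positivity
  -- The shrinkage factor of the posterior mean, the solution of `(1 - c) τ² = c / n`.
  set c : ℝ := n * τ ^ 2 / (1 + n * τ ^ 2) with hcdef
  have h1c : 1 - c = 1 / (1 + n * τ ^ 2) := by rw [hcdef]; field_simp; ring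
  have hc : (1 - c) * τ ^ 2 = c / n := by rw [h1c, hcdef]; field_simp
  have hτ2 : 1 ≤ τ ^ 2 := one_le_pow₀ hτ
  have hnτ : τ ^ 2 ≤ n * τ ^ 2 := by nlinarith
  have hc_half : 1 / 2 ≤ c := by
    rw [hcdef, div_le_div_iff₀ (by norm_num) hden]; linarith
  have hc0 : 0 ≤ 1 - c := by rw [h1c]; positivity
  have hcτ : 1 - c ≤ 1 / τ ^ 2 := by
    rw [h1c]; exact one_div_le_one_div_of_le (by positivity) (by linarith)
  set γ := (stdGaussian (EuclideanSpace ℝ (Fin d))).map (τ • ·)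
  set Γ := Measure.pi fun _ : Fin n => stdGaussian (EuclideanSpace ℝ (Fin d))
  set w : EuclideanSpace ℝ (Fin d) × (Fin n → EuclideanSpace ℝ (Fin d)) →
    (Fin n → EuclideanSpace ℝ (Fin d)) := fun p i => p.1 + p.2 i
  have hwm : Measurable w := by fun_prop
  set g : (Fin n → EuclideanSpace ℝ (Fin d)) → EuclideanSpace ℝ (Fin d) :=
    fun y => clamp l u (m₀ + A (sampleMean y))
  have hgm : Measurable g := by
    refine ((continuous_clamp l u).comp ?_).measurable
    have := continuous_sampleMean (d := d) (n := n)
    fun_prop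
  have hgbox : ∀ y, g y ∈ box l u := fun y => clamp_mem_box hlu _
  set B : ℝ := ∑ i, (|l i| + |u i|)
  have hhB : ∀ y, ‖h y‖ ≤ B := fun y => norm_le_of_mem_box (hbox y)
  have hgB : ∀ y, ‖g y‖ ≤ B := fun y => norm_le_of_mem_box (hgbox y)
  have hγid : Integrable (fun θ : EuclideanSpace ℝ (Fin d) => θ) γ := by
    rw [integrable_map_measure (by fun_prop) (by fun_prop)]
    exact IsGaussian.integrable_id.smul τ
  have hΓid : ∀ i, Integrable (fun z : Fin n → EuclideanSpace ℝ (Fin d) => z i) Γ :=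
    fun i => integrable_eval (μ := fun _ : Fin n => stdGaussian (EuclideanSpace ℝ (Fin d)))
      IsGaussian.integrable_id
  have hfst : Integrable (fun p : EuclideanSpace ℝ (Fin d) × (Fin n → EuclideanSpace ℝ (Fin d)) =>
      p.1) (γ.prod Γ) := hγid.comp_fst Γ
  have hsnd : ∀ i, Integrable
      (fun p : EuclideanSpace ℝ (Fin d) × (Fin n → EuclideanSpace ℝ (Fin d)) => p.2 i)
      (γ.prod Γ) := fun i => (hΓid i).comp_snd γ
  have hmean : Integrable (fun p => sampleMean (w p)) (γ.prod Γ) :=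
    (integrable_finsetSum _ fun i _ => hfst.add (hsnd i)).smul (1 / (n : ℝ))
  have hstate : Integrable (fun p : EuclideanSpace ℝ (Fin d) × (Fin n → EuclideanSpace ℝ (Fin d)) =>
      m₀ + A p.1) (γ.prod Γ) := (integrable_const m₀).add (A.integrable_comp hfst)
  have hpost : Integrable (fun p => m₀ + c • A (sampleMean (w p))) (γ.prod Γ) :=
    (integrable_const m₀).add ((A.integrable_comp hmean).smul c)
  have hΦh := integrable_quadCost (g := fun p => h (w p))
    (hm.comp hwm).aestronglyMeasurable (fun p => hhB (w p)) hstate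
  have hΦg := integrable_quadCost (g := fun p => g (w p))
    (hgm.comp hwm).aestronglyMeasurable (fun p => hgB (w p)) hstate
  have hΨh := integrable_quadCost (g := fun p => h (w p))
    (hm.comp hwm).aestronglyMeasurable (fun p => hhB (w p)) hpost
  have hΨg := integrable_quadCost (g := fun p => g (w p))
    (hgm.comp hwm).aestronglyMeasurable (fun p => hgB (w p)) hpost
  have hΦ : ∫ p, quadCost (h (w p)) (m₀ + A p.1) ∂(γ.prod Γ) ≤
      ∫ p, quadCost (g (w p)) (m₀ + A p.1) ∂(γ.prod Γ) := by
    rw [integral_prod _ hΦh, integral_prod _ hΦg]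
    exact integral_mono hΦh.integral_prod_left hΦg.integral_prod_left hrisk
  have horth : ∫ p, inner ℝ (p.1 - (c / n) • ∑ i, (p.1 + p.2 i))
      (A.adjoint (h (w p) - g (w p))) ∂(γ.prod Γ) = 0 :=
    integral_inner_sub_posteriorMean_eq_zero hn hc
      (ψ := fun y => A.adjoint (h y - g y)) (A.adjoint.continuous.measurable.comp (hm.sub hgm))
  -- The cost is affine in the target, so replacing the state by its posterior mean changes the cost
  -- difference by an inner product with the posterior error, whose integral is zero by `horth`.
  have hpt : ∀ p, (quadCost (h (w p)) (m₀ + c • A (sampleMean (w p))) -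
        quadCost (g (w p)) (m₀ + c • A (sampleMean (w p)))) -
      (quadCost (h (w p)) (m₀ + A p.1) - quadCost (g (w p)) (m₀ + A p.1)) =
      inner ℝ (p.1 - (c / n) • ∑ i, (p.1 + p.2 i)) (A.adjoint (h (w p) - g (w p))) := by
    intro p
    have : (c / n) • ∑ i, (p.1 + p.2 i) = c • sampleMean (w p) := by
      rw [sampleMean, smul_smul, mul_one_div]
    rw [this, ContinuousLinearMap.adjoint_inner_right, map_sub, map_smul]
    simp only [quadCost, inner_sub_left, inner_sub_right, inner_add_left]
    ring
  have hdiff : Integrable (fun p => quadCost (h (w p)) (m₀ + c • A (sampleMean (w p))) -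
    quadCost (g (w p)) (m₀ + c • A (sampleMean (w p)))) (γ.prod Γ) := hΨh.sub hΨg
  have hdiff₀ : Integrable (fun p => quadCost (h (w p)) (m₀ + A p.1) -
    quadCost (g (w p)) (m₀ + A p.1)) (γ.prod Γ) := hΦh.sub hΦg
  have hΨ : ∫ p, (quadCost (h (w p)) (m₀ + c • A (sampleMean (w p))) -
        quadCost (g (w p)) (m₀ + c • A (sampleMean (w p)))) ∂(γ.prod Γ) ≤ 0 := by
    simp_rw [← hpt] at horth
    rw [integral_sub hdiff hdiff₀, integral_sub hΦh hΦg] at horth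
    linarith
  have hsl : ∀ i, Integrable (fun p => 1 / 2 * ((1 - c) * A (sampleMean (w p)) i) ^ 2 *
      if |A (sampleMean (w p)) i| ≤ 2 * (|m₀ i| + |l i| + |u i|) then (1 : ℝ) else 0)
      (γ.prod Γ) := by
    intro i
    simp_rw [apply_eq_inner_adjoint A]
    exact integrable_slab _ _ τ c
  have hsl_le : ∀ i, ∫ p, (1 / 2 * ((1 - c) * A (sampleMean (w p)) i) ^ 2 *
      if |A (sampleMean (w p)) i| ≤ 2 * (|m₀ i| + |l i| + |u i|) then (1 : ℝ) else 0)
      ∂(γ.prod Γ) ≤ (2 * (|m₀ i| + |l i| + |u i|)) ^ 3 /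
      (2 * ‖A.adjoint (EuclideanSpace.single i (1 : ℝ))‖) / τ ^ 5 := by
    intro i
    simp_rw [apply_eq_inner_adjoint A]
    exact integral_slab_le hn _ (by positivity) hτ0 hc0 hcτ
  have hsum := integrable_finsetSum Finset.univ fun i _ => hsl i
  calc ∫ p, ‖h (w p) - g (w p)‖ ^ 2 ∂(γ.prod Γ)
      ≤ ∫ p, (4 * (quadCost (h (w p)) (m₀ + c • A (sampleMean (w p))) -
          quadCost (g (w p)) (m₀ + c • A (sampleMean (w p)))) +
        8 * ∑ i, 1 / 2 * ((1 - c) * A (sampleMean (w p)) i) ^ 2 *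
          if |A (sampleMean (w p)) i| ≤ 2 * (|m₀ i| + |l i| + |u i|) then (1 : ℝ) else 0)
          ∂(γ.prod Γ) := by
        refine integral_mono_of_nonneg (Filter.Eventually.of_forall fun p => sq_nonneg _)
          ((hdiff.const_mul 4).add (hsum.const_mul 8)) (Filter.Eventually.of_forall fun p => ?_)
        exact norm_sub_sq_le hlu m₀ (A (sampleMean (w p))) hc_half (hbox (w p))
    _ ≤ (8 * ∑ i, (2 * (|m₀ i| + |l i| + |u i|)) ^ 3 /
        (2 * ‖A.adjoint (EuclideanSpace.single i (1 : ℝ))‖)) / τ ^ 5 := by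
        rw [integral_add (hdiff.const_mul 4) (hsum.const_mul 8), integral_const_mul,
          integral_const_mul, integral_finsetSum _ fun i _ => hsl i, mul_div_assoc,
          Finset.sum_div]
        have := Finset.sum_le_sum fun i (_ : i ∈ Finset.univ) => hsl_le i
        linarith

/-- A nonnegative function whose mean under `θ ∼ N(0, τ² I)`, `w i = θ + z i` decays like `τ ^ (-5)`
vanishes almost everywhere, in dimension at most `4`. -/
theorem ae_eq_zero_of_lintegral_le (hd : d ≤ 4)
    {f : (Fin n → EuclideanSpace ℝ (Fin d)) → ENNReal} (hfm : Measurable f) (C : ℝ)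
    (hτ : ∀ τ : ℝ, 1 ≤ τ →
      ∫⁻ p : EuclideanSpace ℝ (Fin d) × (Fin n → EuclideanSpace ℝ (Fin d)),
        f (fun i => p.1 + p.2 i) ∂((stdGaussian (EuclideanSpace ℝ (Fin d))).map (τ • ·)).prod
          (Measure.pi fun _ : Fin n => stdGaussian (EuclideanSpace ℝ (Fin d))) ≤
      ENNReal.ofReal (C / τ ^ 5)) :
    f =ᵐ[Measure.pi fun _ : Fin n => stdGaussian (EuclideanSpace ℝ (Fin d))] 0 := by
  set Γ := Measure.pi fun _ : Fin n => stdGaussian (EuclideanSpace ℝ (Fin d))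
  have hfw : Measurable fun p : EuclideanSpace ℝ (Fin d) × (Fin n → EuclideanSpace ℝ (Fin d)) =>
      f fun i => p.1 + p.2 i := hfm.comp (by fun_prop)
  have hone : ∀ τ : ℝ, 1 ≤ τ →
      ∫⁻ θ, ∫⁻ z, f (fun i => θ + z i) ∂Γ ∂(stdGaussian (EuclideanSpace ℝ (Fin d))) ≤
      ENNReal.ofReal (C / τ) := by
    intro τ h1
    have hτ0 : 0 < τ := by linarith
    calc _ ≤ ∫⁻ θ, ∫⁻ z, f (fun i => θ + z i) ∂Γ
          ∂(ENNReal.ofReal τ ^ d • (stdGaussian (EuclideanSpace ℝ (Fin d))).map (τ • ·)) :=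
          lintegral_mono' (stdGaussian_le_smul_map h1) le_rfl
      _ = ENNReal.ofReal τ ^ d * ∫⁻ p, f (fun i => p.1 + p.2 i)
          ∂((stdGaussian (EuclideanSpace ℝ (Fin d))).map (τ • ·)).prod Γ := by
          rw [lintegral_smul_measure, lintegral_prod _ hfw.aemeasurable, smul_eq_mul]
      -- The hypothesis `d ≤ 4` enters here, leaving one power of `τ` to spare.
      _ ≤ ENNReal.ofReal τ ^ 4 * ENNReal.ofReal (C / τ ^ 5) := by
          gcongr
          · simpa using h1
          · exact hτ τ h1
      _ = ENNReal.ofReal (C / τ) := by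
          rw [← ENNReal.ofReal_pow hτ0.le, ← ENNReal.ofReal_mul (by positivity)]
          congr 1
          field_simp
  have hzero : ∫⁻ θ, ∫⁻ z, f (fun i => θ + z i) ∂Γ ∂(stdGaussian (EuclideanSpace ℝ (Fin d))) = 0 := by
    have hlim : Filter.Tendsto (fun τ : ℝ => ENNReal.ofReal (C / τ)) Filter.atTop (nhds 0) := by
      simpa using ENNReal.tendsto_ofReal (Filter.Tendsto.const_div_atTop Filter.tendsto_id C)
    exact le_antisymm (ge_of_tendsto hlim
      ((Filter.eventually_ge_atTop 1).mono fun τ h1 => hone τ h1)) bot_le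
  have hinner : Measurable fun θ : EuclideanSpace ℝ (Fin d) => ∫⁻ z, f (fun i => θ + z i) ∂Γ :=
    hfw.lintegral_prod_right'
  rw [lintegral_eq_zero_iff hinner] at hzero
  obtain ⟨θ, hθ⟩ := hzero.exists
  have hθ' : ∫⁻ z, f (fun i => θ + z i) ∂Γ = 0 := hθ
  have hfθ : Measurable fun z : Fin n → EuclideanSpace ℝ (Fin d) => f fun i => θ + z i :=
    hfw.comp measurable_prodMk_left
  rw [lintegral_eq_zero_iff hfθ] at hθ'
  -- A single good `θ` suffices: translating back by `-θ` preserves null sets.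
  filter_upwards [ae_pi_stdGaussian_const_add (-θ) hθ'] with z hz
  simpa only [add_neg_cancel_left, Pi.zero_apply] using hz

/-- In dimension at most `4`, a rule with values in the box whose risk is nowhere larger than that
of the projection of `m₀ + A w̄` coincides with it almost everywhere. -/
theorem ae_eq_clamp_of_risk_le (hd : d ≤ 4) (hn : n ≠ 0) {l u : Fin d → ℝ} (hlu : ∀ i, l i ≤ u i)
    (A : EuclideanSpace ℝ (Fin d) →L[ℝ] EuclideanSpace ℝ (Fin d)) (m₀ : EuclideanSpace ℝ (Fin d))
    {h : (Fin n → EuclideanSpace ℝ (Fin d)) → EuclideanSpace ℝ (Fin d)} (hm : Measurable h)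
    (hbox : ∀ w, h w ∈ box l u)
    (hrisk : ∀ θ : EuclideanSpace ℝ (Fin d),
      ∫ z, quadCost (h fun i => θ + z i) (m₀ + A θ)
        ∂(Measure.pi fun _ : Fin n => stdGaussian (EuclideanSpace ℝ (Fin d))) ≤
      ∫ z, quadCost (clamp l u (m₀ + A (sampleMean fun i => θ + z i))) (m₀ + A θ)
        ∂(Measure.pi fun _ : Fin n => stdGaussian (EuclideanSpace ℝ (Fin d)))) :
    h =ᵐ[Measure.pi fun _ : Fin n => stdGaussian (EuclideanSpace ℝ (Fin d))]
      fun w => clamp l u (m₀ + A (sampleMean w)) := by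
  set Γ := Measure.pi fun _ : Fin n => stdGaussian (EuclideanSpace ℝ (Fin d))
  set g : (Fin n → EuclideanSpace ℝ (Fin d)) → EuclideanSpace ℝ (Fin d) :=
    fun y => clamp l u (m₀ + A (sampleMean y))
  have hgm : Measurable g := by
    refine ((continuous_clamp l u).comp ?_).measurable
    have := continuous_sampleMean (d := d) (n := n)
    fun_prop
  set C : ℝ := 8 * ∑ i, (2 * (|m₀ i| + |l i| + |u i|)) ^ 3 /
      (2 * ‖A.adjoint (EuclideanSpace.single i (1 : ℝ))‖)
  set f : (Fin n → EuclideanSpace ℝ (Fin d)) → ENNReal := fun y =>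
    ENNReal.ofReal (‖h y - g y‖ ^ 2) with hf
  have hfm : Measurable f := ((hm.sub hgm).norm.pow_const 2).ennreal_ofReal
  have hwm : Measurable fun p : EuclideanSpace ℝ (Fin d) × (Fin n → EuclideanSpace ℝ (Fin d)) =>
      fun i => p.1 + p.2 i := by fun_prop
  have hτ : ∀ τ : ℝ, 1 ≤ τ → ∫⁻ p : EuclideanSpace ℝ (Fin d) × (Fin n → EuclideanSpace ℝ (Fin d)),
      f (fun i => p.1 + p.2 i) ∂((stdGaussian (EuclideanSpace ℝ (Fin d))).map (τ • ·)).prod Γ ≤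
      ENNReal.ofReal (C / τ ^ 5) := by
    intro τ h1
    have hint : Integrable (fun p : EuclideanSpace ℝ (Fin d) × (Fin n → EuclideanSpace ℝ (Fin d)) =>
        ‖h (fun i => p.1 + p.2 i) - g (fun i => p.1 + p.2 i)‖ ^ 2)
        (((stdGaussian (EuclideanSpace ℝ (Fin d))).map (τ • ·)).prod Γ) := by
      refine Integrable.of_bound (C := (∑ i, (|l i| + |u i|) + ∑ i, (|l i| + |u i|)) ^ 2)
        (((hm.comp hwm).sub (hgm.comp hwm)).norm.pow_const 2).aestronglyMeasurable
        (Filter.Eventually.of_forall fun p => ?_)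
      rw [Real.norm_of_nonneg (sq_nonneg _)]
      refine pow_le_pow_left₀ (norm_nonneg _) ((norm_sub_le _ _).trans ?_) 2
      exact add_le_add (norm_le_of_mem_box (hbox _)) (norm_le_of_mem_box (clamp_mem_box hlu _))
    simp only [hf]
    rw [← ofReal_integral_eq_lintegral_ofReal hint
      (Filter.Eventually.of_forall fun p => sq_nonneg _)]
    exact ENNReal.ofReal_le_ofReal
      (integral_norm_sub_clamp_sq_le hn hlu A m₀ hm hbox hrisk h1)
  filter_upwards [ae_eq_zero_of_lintegral_le hd hfm C hτ] with z hz
  simp only [Pi.zero_apply, hf, ENNReal.ofReal_eq_zero] at hz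
  have h0 : ‖h z - g z‖ = 0 := by nlinarith [norm_nonneg (h z - g z)]
  exact sub_eq_zero.1 (norm_eq_zero.1 h0)

end StochOpt

/-! ### Reduction of the sampling model to standard Gaussians -/

namespace StochOpt

variable {d n : ℕ}

theorem objective_quadCost (μ : EuclideanSpace ℝ (Fin d)) (S : Matrix (Fin d) (Fin d) ℝ)
    (x : EuclideanSpace ℝ (Fin d)) :
    objective quadCost (multivariateGaussian μ S) x = quadCost x μ := by
  have hid : Integrable (fun ξ : EuclideanSpace ℝ (Fin d) => ξ) (multivariateGaussian μ S) :=
    IsGaussian.integrable_id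
  have h : ∫ ξ, inner ℝ x ξ ∂(multivariateGaussian μ S) = inner ℝ x μ := by
    rw [integral_inner hid, integral_id_multivariateGaussian]
  simp only [objective, quadCost]
  simp_rw [real_inner_comm x]
  rw [integral_sub (integrable_const _) (hid.const_inner x), h]
  simp

open scoped MatrixOrder in
/-- The linear map with matrix `√S`. -/
noncomputable def covSqrt (S : Matrix (Fin d) (Fin d) ℝ) :
    EuclideanSpace ℝ (Fin d) →L[ℝ] EuclideanSpace ℝ (Fin d) :=
  Matrix.toEuclideanCLM (𝕜 := ℝ) (CFC.sqrt S)

theorem multivariateGaussian_eq_map_covSqrt (μ : EuclideanSpace ℝ (Fin d))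
    (S : Matrix (Fin d) (Fin d) ℝ) :
    multivariateGaussian μ S =
      (stdGaussian (EuclideanSpace ℝ (Fin d))).map fun x => μ + covSqrt S x := rfl

theorem sampleLaw_multivariateGaussian (m₀ θ : EuclideanSpace ℝ (Fin d))
    (S : Matrix (Fin d) (Fin d) ℝ) :
    sampleLaw n (multivariateGaussian
      (m₀ + covSqrt S θ) S) =
    (Measure.pi fun _ : Fin n => stdGaussian (EuclideanSpace ℝ (Fin d))).map
      (fun z i => m₀ + covSqrt S (θ + z i)) := by
  have h := Measure.pi_map_pi (μ := fun _ : Fin n => stdGaussian (EuclideanSpace ℝ (Fin d)))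
    (f := fun _ z => m₀ + covSqrt S (θ + z))
    (fun _ => by fun_prop)
  rw [h, sampleLaw]
  simp only [multivariateGaussian_eq_map_covSqrt, map_add, add_assoc]

/-- The optimal value does not depend on the rule, so comparing risks amounts to comparing the
integrals. Agreement of `δ` and `h` is assumed only at the base state and is transported to every
`θ` by translation. -/
theorem risk_eq {l u : Fin d → ℝ} {S : Matrix (Fin d) (Fin d) ℝ}
    {δ : (Fin n → EuclideanSpace ℝ (Fin d)) → EuclideanSpace ℝ (Fin d)}
    (hδ : δ ∈ decisionRules (box l u)
      (fun μ : EuclideanSpace ℝ (Fin d) => multivariateGaussian μ S) n)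
    (m₀ : EuclideanSpace ℝ (Fin d))
    {h : (Fin n → EuclideanSpace ℝ (Fin d)) → EuclideanSpace ℝ (Fin d)}
    (hh : ∀ᵐ w ∂(Measure.pi fun _ : Fin n => stdGaussian (EuclideanSpace ℝ (Fin d))),
      δ (fun i => m₀ + covSqrt S (w i)) = h w)
    (θ : EuclideanSpace ℝ (Fin d)) :
    risk quadCost (box l u) (fun μ : EuclideanSpace ℝ (Fin d) => multivariateGaussian μ S) n
      (m₀ + covSqrt S θ) δ =
    ∫ z, quadCost (h fun i => θ + z i) (m₀ + covSqrt S θ)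
      ∂(Measure.pi fun _ : Fin n => stdGaussian (EuclideanSpace ℝ (Fin d))) -
    sInf ((fun x => quadCost x (m₀ + covSqrt S θ)) '' box l u)
    := by
  set μ := m₀ + covSqrt S θ with hμ
  have : IsProbabilityMeasure (sampleLaw n (multivariateGaussian μ S)) := by
    unfold sampleLaw; infer_instance
  have hobj : objective quadCost (multivariateGaussian μ S) = fun x => quadCost x μ :=
    funext (objective_quadCost μ S)
  have hint : Integrable (fun y => quadCost (δ y) μ) (sampleLaw n (multivariateGaussian μ S)) :=
    integrable_quadCost (hδ.2 μ).aestronglyMeasurable (fun y => norm_le_of_mem_box (hδ.1 y))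
      (integrable_const μ)
  simp only [risk, loss, hobj]
  rw [integral_sub hint (integrable_const _), integral_const, probReal_univ, one_smul]
  congr 1
  have hlaw := sampleLaw_multivariateGaussian (n := n) m₀ θ S
  have hasm := hint.aestronglyMeasurable
  rw [hlaw] at hasm ⊢
  have hm : Measurable fun (z : Fin n → EuclideanSpace ℝ (Fin d)) i => m₀ + covSqrt S (θ + z i) := by
    fun_prop
  rw [integral_map hm.aemeasurable hasm]
  refine integral_congr_ae ?_
  filter_upwards [ae_pi_stdGaussian_const_add θ hh] with z hz
  rw [hz]

/-- Integrability provides measurability only up to null sets of each law. A single version taken at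
`m₀` serves all states `m₀ + A θ`; clamping it restores values in the box without changing it where
it equals `δ`. -/
theorem exists_measurable_version {l u : Fin d → ℝ} (hlu : ∀ i, l i ≤ u i)
    {S : Matrix (Fin d) (Fin d) ℝ}
    {δ : (Fin n → EuclideanSpace ℝ (Fin d)) → EuclideanSpace ℝ (Fin d)}
    (hδ : δ ∈ decisionRules (box l u)
      (fun μ : EuclideanSpace ℝ (Fin d) => multivariateGaussian μ S) n)
    (m₀ : EuclideanSpace ℝ (Fin d)) :
    ∃ h : (Fin n → EuclideanSpace ℝ (Fin d)) → EuclideanSpace ℝ (Fin d),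
      Measurable h ∧ (∀ w, h w ∈ box l u) ∧
      ∀ᵐ w ∂(Measure.pi fun _ : Fin n => stdGaussian (EuclideanSpace ℝ (Fin d))),
        δ (fun i => m₀ + covSqrt S (w i)) = h w := by
  have h0 := (hδ.2 m₀).aestronglyMeasurable
  have hlaw := sampleLaw_multivariateGaussian (n := n) m₀ 0 S
  simp only [map_zero, add_zero, zero_add] at hlaw
  rw [hlaw] at h0
  have h1 := h0.comp_measurable (by fun_prop)
  refine ⟨fun w => clamp l u (h1.mk _ w),
    (continuous_clamp l u).measurable.comp h1.stronglyMeasurable_mk.measurable,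
    fun w => clamp_mem_box hlu _, ?_⟩
  filter_upwards [h1.ae_eq_mk] with w hw
  rw [← hw]
  ext i
  obtain ⟨ha, hb⟩ := hδ.1 (fun i => m₀ + covSqrt S (w i)) i
  simp only [Function.comp_apply, clamp_apply, clampReal]
  rw [min_eq_right hb, max_eq_right ha]

theorem clamp_sampleMean_mem_decisionRules {l u : Fin d → ℝ} (hlu : ∀ i, l i ≤ u i)
    (S : Matrix (Fin d) (Fin d) ℝ) :
    (fun y => clamp l u (sampleMean y)) ∈ decisionRules (box l u)
      (fun μ : EuclideanSpace ℝ (Fin d) => multivariateGaussian μ S) n := by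
  refine ⟨fun y => clamp_mem_box hlu _, fun μ => ?_⟩
  have : IsProbabilityMeasure (sampleLaw n (multivariateGaussian μ S)) := by
    unfold sampleLaw; infer_instance
  refine Integrable.of_bound (C := ∑ i, (|l i| + |u i|)) ?_
    (Filter.Eventually.of_forall fun y => norm_le_of_mem_box (clamp_mem_box hlu _))
  exact ((continuous_clamp l u).comp continuous_sampleMean).aestronglyMeasurable

theorem isAdmissible_clamp_sampleMean (hd : d ≤ 4) (hn : n ≠ 0) {l u : Fin d → ℝ}
    (hlu : ∀ i, l i ≤ u i) (S : Matrix (Fin d) (Fin d) ℝ) :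
    IsAdmissible quadCost (box l u)
      (fun μ : EuclideanSpace ℝ (Fin d) => multivariateGaussian μ S) n
      (fun y => clamp l u (sampleMean y)) := by
  have hSA := clamp_sampleMean_mem_decisionRules (n := n) hlu S
  refine ⟨hSA, ?_⟩
  rintro ⟨δ, hδ, hle, m₀, hlt⟩
  -- The base point is the state of strict improvement, so that equality almost everywhere
  -- contradicts `hlt` at `θ = 0`.
  obtain ⟨h, hm, hbox, hh⟩ := exists_measurable_version hlu hδ m₀
  set A := covSqrt S
  have hSAeq : ∀ᵐ w ∂(Measure.pi fun _ : Fin n => stdGaussian (EuclideanSpace ℝ (Fin d))),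
      clamp l u (sampleMean fun i => m₀ + A (w i)) = clamp l u (m₀ + A (sampleMean w)) :=
    Filter.Eventually.of_forall fun w => by rw [sampleMean_affine hn]
  have hae : h =ᵐ[Measure.pi fun _ : Fin n => stdGaussian (EuclideanSpace ℝ (Fin d))]
      fun w => clamp l u (m₀ + A (sampleMean w)) := by
    refine ae_eq_clamp_of_risk_le hd hn hlu A m₀ hm hbox fun θ => ?_
    have := hle (m₀ + A θ)
    rw [risk_eq hδ m₀ hh θ, risk_eq hSA m₀ hSAeq θ] at this
    linarith
  have hδeq : ∀ᵐ w ∂(Measure.pi fun _ : Fin n => stdGaussian (EuclideanSpace ℝ (Fin d))),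
      δ (fun i => m₀ + A (w i)) = clamp l u (m₀ + A (sampleMean w)) := by
    filter_upwards [hh, hae] with w h1 h2
    rw [h1, h2]
  have h1 := risk_eq hδ m₀ hδeq 0
  have h2 := risk_eq hSA m₀ hSAeq 0
  simp only [map_zero, add_zero] at h1 h2
  rw [h1, h2] at hlt
  exact lt_irrefl _ hlt

end StochOpt

theorem theorem2 (d : ℕ) (hd : d ≤ 4) (l u : Fin d → ℝ) (hlu : ∀ i, l i ≤ u i)
    (n : ℕ) (hn : 1 ≤ n) (S : Matrix (Fin d) (Fin d) ℝ) (hS : S.PosSemidef) :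
    (∃! δ : (Fin n → EuclideanSpace ℝ (Fin d)) → EuclideanSpace ℝ (Fin d),
      StochOpt.IsSampleAverageRule StochOpt.quadCost (StochOpt.box l u) n δ) ∧
    ∀ δ : (Fin n → EuclideanSpace ℝ (Fin d)) → EuclideanSpace ℝ (Fin d),
      StochOpt.IsSampleAverageRule StochOpt.quadCost (StochOpt.box l u) n δ →
        (∀ y, StochOpt.IsArgmin
          (fun x => 1 / 2 * ‖x‖ ^ 2 - inner ℝ (StochOpt.sampleMean y) x)
          (StochOpt.box l u) (δ y)) ∧
        (∀ y, StochOpt.IsArgmin (fun x => ‖StochOpt.sampleMean y - x‖)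
          (StochOpt.box l u) (δ y)) ∧
        StochOpt.IsAdmissible StochOpt.quadCost (StochOpt.box l u)
          (fun μ : EuclideanSpace ℝ (Fin d) => multivariateGaussian μ S) n δ := by
  have hn' : n ≠ 0 := Nat.one_le_iff_ne_zero.1 hn
  simp only [StochOpt.isSampleAverageRule_iff hlu hn']
  refine ⟨⟨_, rfl, fun _ h => h⟩, ?_⟩
  rintro δ rfl
  exact ⟨fun y => (StochOpt.isArgmin_quadCost_iff hlu _ _).2 rfl,
    fun y => StochOpt.isArgmin_norm_sub_clamp hlu _,
    StochOpt.isAdmissible_clamp_sampleMean hd hn' hlu S⟩
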